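/- There is an absolute constant $C>0$ such that the following holds for every finite simple graph $G=(V,E)$ with $n$ vertices and maximum degree $\Delta$. Consider the decentralized coloring algorithm: start with a coloring $c_0\colon V\to\{1,\dots,\Delta+1\}$ in which each vertex receives a color independently and uniformly at random; then, as long as the current coloring $c_{t}$ is not proper, choose a vertex $v$ uniformly at random among all vertices that have a neighbor of the same color, and obtain $c_{t+1}$ from $c_t$ by recoloring $v$ with a color chosen uniformly at random from $\{1,\dots,\Delta+1\}$ (possibly its old one), all other vertices keeping their colors. Let $T=\min\{t\ge 0 : c_t \text{ is a proper coloring of } G\}$ be the number of recoloring steps (with $T=\infty$ if no $c_t$ is proper). Then $$\mathbb{E}[T]\le C\,n\log\bigl(\max\{\Delta,2\}\bigr),$$ so the algorithm finds a proper $(\Delta+1)$-coloring after $O(n\log\Delta)$ expected recoloring steps when $\Delta\ge 2$. The same bound, with the same constant $C$, holds if instead the algorithm is started from an arbitrary, adversarially chosen, fixed initial coloring $c_0\colon V\to\{1,\dots,\Delta+1\}$. -/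

import Mathlib

open MeasureTheory ProbabilityTheory
open scoped ENNReal

namespace DecentralizedColoring

universe u

section

variable {V : Type u} [Fintype V] [DecidableEq V] (G : SimpleGraph V) [DecidableRel G.Adj]

/-- Colour assignments (proper or not) with the `Δ + 1` colours `{0, …, Δ}`, where `Δ` is the
maximum degree of `G`. -/
abbrev Assignment : Type u := V → Fin (G.maxDegree + 1)

/-- The assignment `c` is a proper colouring of `G`. -/
def IsProper (c : Assignment G) : Prop := ∀ v w, G.Adj v w → c v ≠ c w

/-- The conflicted vertices: those with a neighbour of the same colour. -/
def conflicted (c : Assignment G) : Finset V := {v | ∃ w, G.Adj v w ∧ c v = c w}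

/-- The law of the assignment after one recolouring step from `c`: a uniformly random conflicted
vertex receives a uniformly random colour. If no vertex is conflicted, the algorithm has stopped,
and the assignment stays as it is. -/
noncomputable def recolor (c : Assignment G) : PMF (Assignment G) :=
  if h : (conflicted G c).Nonempty then
    (PMF.uniformOfFinset (conflicted G c) h).bind fun v =>
      (PMF.uniformOfFintype (Fin (G.maxDegree + 1))).map fun x => Function.update c v x
  else PMF.pure c

/-- The transition kernel at time `t`: given the assignments at the times `0, …, t`, a recolouring
step is performed from the one at time `t`. -/
noncomputable def stepKernel (t : ℕ) :
    Kernel ((i : Finset.Iic t) → (fun _ : ℕ => Assignment G) i) (Assignment G) :=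
  Kernel.ofFunOfCountable fun h => (recolor G (h ⟨t, Finset.mem_Iic.2 le_rfl⟩)).toMeasure

instance (t : ℕ) : IsMarkovKernel (stepKernel G t) :=
  ⟨fun h => PMF.toMeasure.isProbabilityMeasure (recolor G (h ⟨t, Finset.mem_Iic.2 le_rfl⟩))⟩

/-- The law of the whole run `c₀, c₁, c₂, …` of the algorithm when `c₀` has law `μ₀`. -/
noncomputable def runLaw (μ₀ : Measure (Assignment G)) : Measure (ℕ → Assignment G) :=
  Kernel.trajMeasure (X := fun _ : ℕ => Assignment G) μ₀ (stepKernel G)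

/-- The number of recolouring steps of a run: the first time at which the assignment is a proper
colouring, and `∞` if there is no such time. -/
noncomputable def steps (c : ℕ → Assignment G) : ℝ≥0∞ :=
  ⨅ (t : ℕ) (_ : IsProper G (c t)), (t : ℝ≥0∞)

/-- The expected number of recolouring steps when the initial assignment has law `μ₀`. -/
noncomputable def expectedSteps (μ₀ : Measure (Assignment G)) : ℝ≥0∞ :=
  ∫⁻ c, steps G c ∂(runLaw G μ₀)

/-- The initial law of the algorithm: every vertex independently gets a uniform colour. -/
noncomputable def uniformStart : Measure (Assignment G) :=
  Measure.pi fun _ : V => (PMF.uniformOfFintype (Fin (G.maxDegree + 1))).toMeasure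

end

end DecentralizedColoring

/-!
The proof exhibits a nonnegative function `lyapunov` of the colouring, bounded by
`48 n log (max Δ 2)`, that drops by at least `1` in expectation at every step from an improper
colouring. Summing over time bounds the expected number of steps by its maximum
(`expectedSteps_le_ofReal`), whatever the initial law.

Write `D = Δ + 1`, `U` for the set of conflicted vertices, `k = |U|`, `M` for the number of ordered
monochromatic adjacent pairs (`monoSum`), `F` for the number of ordered adjacent pairs inside `U`
(`edgeSum`), and `σ = ∑ v ∈ U, (D - deg v)` (`degreeDeficit`), so `k ≤ σ` and `k ≤ M`. Summed over
all `v ∈ U` and all `D` colours, a recolouring changes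
* `M` by exactly `-2 (D (M - k) + σ)`, which is tiny when the conflicts form a matching and all
  conflicted vertices have degree `Δ` (`sum_drift_monoSum`);
* `k` by at most `D (M - k) - F`: a conflict that moves onto a conflicted vertex creates fewer new
  conflicted vertices (`sum_drift_card_le`);
* `F` by at least `2 ∑ w, deg_U(w) ^ 2 - D (6 F + 4 σ)`: conflicts move to random neighbours, and so
  towards vertices with many conflicted neighbours (`le_sum_drift_edgeSum`).

By Cauchy–Schwarz `∑ w, deg_U(w) ^ 2 ≥ (D k - σ) ^ 2 / n`. In the combination
`6 D (M + k) - F` (`potential`), the undesired terms cancel, and its expected change in one step is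
at most `-(1 + potential / n) / 6` (`sum_drift_potential_le`): the drift is multiplicative at rate
`1 / n` while the potential exceeds `n`, and constant below. As the potential is at most
`12 n D ^ 2`, the concave transform `6 n log (1 + potential / n)` is the required function.
-/

namespace DecentralizedColoring

universe u

/-! ### From a one-step drift to the expected number of steps -/

section ExpectedSteps

variable {V : Type u} [Fintype V] (G : SimpleGraph V) [DecidableRel G.Adj]

open Classical in
lemma steps_le_tsum (c : ℕ → Assignment G) :
    steps G c ≤ ∑' t, if IsProper G (c t) then (0 : ℝ≥0∞) else 1 := by
  by_cases h : ∃ t, IsProper G (c t)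
  · calc steps G c ≤ (Nat.find h : ℝ≥0∞) := iInf₂_le_of_le (Nat.find h) (Nat.find_spec h) le_rfl
      _ = ∑ t ∈ Finset.range (Nat.find h), if IsProper G (c t) then (0 : ℝ≥0∞) else 1 := by
        rw [Finset.sum_congr rfl fun t ht => if_neg (Nat.find_min h (Finset.mem_range.1 ht))]
        simp
      _ ≤ _ := ENNReal.sum_le_tsum _
  · push Not at h
    simp [h]

lemma not_nonempty_conflicted_iff {c : Assignment G} : ¬ (conflicted G c).Nonempty ↔ IsProper G c := by
  simp [Finset.not_nonempty_iff_eq_empty, conflicted, IsProper, Finset.filter_eq_empty_iff]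

lemma lintegral_toMeasure {α : Type*} [MeasurableSpace α] [MeasurableSingletonClass α] [Countable α]
    (p : PMF α) (f : α → ℝ≥0∞) :
    ∫⁻ a, f a ∂p.toMeasure = ∑' a, p a * f a := by
  rw [lintegral_countable']
  simp [PMF.toMeasure_apply_singleton, mul_comm]

variable [DecidableEq V]

/-- The Markov property of the run, in integrated form. -/
lemma lintegral_runLaw_succ (μ₀ : Measure (Assignment G)) [IsProbabilityMeasure μ₀]
    (f : Assignment G → ℝ≥0∞) (t : ℕ) :
    ∫⁻ c, f (c (t + 1)) ∂(runLaw G μ₀) =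
      ∫⁻ c, ∫⁻ c', f c' ∂(recolor G (c t)).toMeasure ∂(runLaw G μ₀) := by
  have hf : Measurable f := Measurable.of_discrete
  have key := Kernel.map_frestrictLe_trajMeasure_compProd_eq_map_trajMeasure
    (X := fun _ : ℕ => Assignment G) (μ₀ := μ₀) (κ := stepKernel G) (a := t)
  have h := congrArg (fun μ => ∫⁻ p, f p.2 ∂μ) key
  rw [Measure.lintegral_compProd (by fun_prop), lintegral_map (by fun_prop) (by fun_prop),
    lintegral_map (by fun_prop) (by fun_prop)] at h
  exact h.symm

lemma lintegral_recolor {c : Assignment G} (h : (conflicted G c).Nonempty)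
    (f : Assignment G → ℝ≥0∞) :
    ∫⁻ c', f c' ∂(recolor G c).toMeasure =
      ((conflicted G c).card : ℝ≥0∞)⁻¹ * ∑ v ∈ conflicted G c,
        ((G.maxDegree + 1 : ℕ) : ℝ≥0∞)⁻¹ * ∑ x, f (Function.update c v x) := by
  rw [lintegral_toMeasure, recolor, dif_pos h]
  simp only [PMF.bind_apply, PMF.map_apply, ← ENNReal.tsum_mul_right]
  rw [ENNReal.tsum_comm, tsum_fintype, Finset.mul_sum,
    ← Finset.sum_subset (Finset.subset_univ (conflicted G c))]
  · refine Finset.sum_congr rfl fun v hv => ?_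
    rw [PMF.uniformOfFinset_apply_of_mem _ hv]
    simp only [mul_assoc, ENNReal.tsum_mul_left]
    congr 1
    simp only [← ENNReal.tsum_mul_right]
    rw [ENNReal.tsum_comm, tsum_fintype, Finset.mul_sum]
    refine Finset.sum_congr rfl fun x _ => ?_
    rw [tsum_eq_single (Function.update c v x) (by intro b hb; simp [hb])]
    simp
  · intro v _ hv
    simp [PMF.uniformOfFinset_apply_of_notMem _ hv]

/-- A bounded function that decreases by at least `1` in expectation at every step from an improper
colouring bounds the expected number of steps. -/
theorem expectedSteps_le (μ₀ : Measure (Assignment G)) [IsProbabilityMeasure μ₀]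
    (L : Assignment G → ℝ≥0∞) (B : ℝ≥0∞) (hB : ∀ c, L c ≤ B)
    (hL : ∀ c, ¬ IsProper G c → ∫⁻ c', L c' ∂(recolor G c).toMeasure + 1 ≤ L c) :
    expectedSteps G μ₀ ≤ B := by
  classical
  -- the number of steps is at most the number of times `t` with `N (c t) = 1`
  set N : Assignment G → ℝ≥0∞ := fun c => if IsProper G c then 0 else 1 with hN
  have hstep : ∀ c, ∫⁻ c', L c' ∂(recolor G c).toMeasure + N c ≤ L c := by
    intro c
    by_cases hc : IsProper G c
    · have := (not_nonempty_conflicted_iff G).2 hc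
      simp [hN, hc, recolor, this, PMF.toMeasure_pure]
    · simpa [hN, hc] using hL c hc
  have hprob : IsProbabilityMeasure (runLaw G μ₀) := by unfold runLaw; infer_instance
  have hmeas : ∀ (f : Assignment G → ℝ≥0∞) (t : ℕ),
      Measurable fun c : ℕ → Assignment G => f (c t) :=
    fun f t => (Measurable.of_discrete (f := f)).comp (measurable_pi_apply t)
  have htel : ∀ n : ℕ, ∫⁻ c, L (c n) ∂(runLaw G μ₀) +
      ∑ t ∈ Finset.range n, ∫⁻ c, N (c t) ∂(runLaw G μ₀) ≤ B := by
    intro n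
    induction n with
    | zero =>
      simp only [Finset.range_zero, Finset.sum_empty, add_zero]
      calc _ ≤ ∫⁻ _, B ∂(runLaw G μ₀) := lintegral_mono fun c => hB _
        _ = B := by simp
    | succ n ih =>
      refine le_trans ?_ ih
      rw [Finset.sum_range_succ, add_comm (Finset.sum _ _), ← add_assoc, lintegral_runLaw_succ]
      gcongr
      rw [← lintegral_add_right _ (hmeas N n)]
      exact lintegral_mono fun c => hstep _
  calc expectedSteps G μ₀ ≤ ∫⁻ c, ∑' t, N (c t) ∂(runLaw G μ₀) :=
        lintegral_mono fun c => steps_le_tsum G c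
    _ = ∑' t, ∫⁻ c, N (c t) ∂(runLaw G μ₀) := lintegral_tsum fun t => (hmeas N t).aemeasurable
    _ ≤ B := ENNReal.tsum_le_of_sum_range_le fun n => le_trans le_add_self (htel n)

/-- Real-valued form of `expectedSteps_le`, with the expectation over the recoloured vertex and its
new colour written as an unnormalized sum. -/
theorem expectedSteps_le_ofReal (μ₀ : Measure (Assignment G)) [IsProbabilityMeasure μ₀]
    (L : Assignment G → ℝ) (B : ℝ) (hL0 : ∀ c, 0 ≤ L c) (hB : ∀ c, L c ≤ B)
    (hL : ∀ c, (conflicted G c).Nonempty →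
      ∑ v ∈ conflicted G c, ∑ x, (L (Function.update c v x) - L c) ≤
        -((conflicted G c).card * (G.maxDegree + 1))) :
    expectedSteps G μ₀ ≤ ENNReal.ofReal B := by
  refine expectedSteps_le G μ₀ (fun c => ENNReal.ofReal (L c)) _
    (fun c => ENNReal.ofReal_le_ofReal (hB c)) fun c hc => ?_
  have hne : (conflicted G c).Nonempty := by
    by_contra h
    exact hc ((not_nonempty_conflicted_iff G).1 h)
  have hk : (0 : ℝ) < (conflicted G c).card := by exact_mod_cast hne.card_pos
  have hD : (0 : ℝ) < G.maxDegree + 1 := by positivity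
  have h := hL c hne
  simp only [Finset.sum_sub_distrib, Finset.sum_const, Finset.card_univ, Fintype.card_fin,
    nsmul_eq_mul, Nat.cast_add, Nat.cast_one] at h
  have hS : ∀ v, 0 ≤ ∑ x, L (Function.update c v x) := fun v => Finset.sum_nonneg fun x _ => hL0 _
  rw [lintegral_recolor G hne]
  simp only [← Finset.mul_sum, ← ENNReal.ofReal_sum_of_nonneg (fun x _ => hL0 _),
    ← ENNReal.ofReal_sum_of_nonneg (fun v _ => hS v)]
  rw [← ENNReal.ofReal_natCast, ← ENNReal.ofReal_natCast, ← ENNReal.ofReal_inv_of_pos hk,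
    ← ENNReal.ofReal_inv_of_pos (by push_cast; exact hD), ← ENNReal.ofReal_mul (by positivity),
    ← ENNReal.ofReal_mul (by positivity), ← ENNReal.ofReal_one, ← ENNReal.ofReal_add _ zero_le_one]
  · apply ENNReal.ofReal_le_ofReal
    push_cast
    set S := ∑ v ∈ conflicted G c, ∑ x, L (Function.update c v x)
    have : S ≤ (conflicted G c).card * ((G.maxDegree + 1) * (L c - 1)) := by linarith
    have h2 : ((conflicted G c).card : ℝ)⁻¹ * ((G.maxDegree + 1 : ℝ)⁻¹ * S) ≤ L c - 1 := by
      rw [inv_mul_le_iff₀ hk, inv_mul_le_iff₀ hD]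
      linarith
    linarith
  · have := Finset.sum_nonneg fun v (_ : v ∈ conflicted G c) => hS v
    positivity

end ExpectedSteps

/-! ### Counting edges inside a set of vertices -/

section EdgeCounts

variable {V : Type u} (G : SimpleGraph V) [DecidableRel G.Adj]

/-- The number of neighbours of `v` in `S`, as a real number. -/
def degIn (S : Finset V) (v : V) : ℝ := ∑ w ∈ S, if G.Adj v w then 1 else 0

/-- The number of ordered pairs of adjacent vertices in `S`, as a real number. -/
def edgeSum (S : Finset V) : ℝ := ∑ v ∈ S, degIn G S v

variable {G}

lemma degIn_nonneg (S : Finset V) (v : V) : 0 ≤ degIn G S v :=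
  Finset.sum_nonneg fun _ _ => by split_ifs <;> norm_num

lemma sum_degIn_comm (S T : Finset V) :
    ∑ v ∈ S, degIn G T v = ∑ v ∈ T, degIn G S v := by
  simp only [degIn]
  rw [Finset.sum_comm]
  simp only [G.adj_comm]

lemma edgeSum_nonneg (S : Finset V) : 0 ≤ edgeSum G S :=
  Finset.sum_nonneg fun _ _ => degIn_nonneg _ _

section

variable [DecidableEq V]

lemma degIn_union {S T : Finset V} (h : Disjoint S T) (v : V) :
    degIn G (S ∪ T) v = degIn G S v + degIn G T v :=
  Finset.sum_union h

lemma edgeSum_union {S T : Finset V} (h : Disjoint S T) :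
    edgeSum G (S ∪ T) = edgeSum G S + 2 * ∑ v ∈ T, degIn G S v + edgeSum G T := by
  simp only [edgeSum, degIn_union h, Finset.sum_union h, Finset.sum_add_distrib]
  rw [sum_degIn_comm S T]
  ring

lemma edgeSum_mono {S T : Finset V} (h : S ⊆ T) : edgeSum G S ≤ edgeSum G T := by
  rw [← Finset.union_sdiff_of_subset h, edgeSum_union Finset.disjoint_sdiff]
  have h1 := edgeSum_nonneg (G := G) (T \ S)
  have h2 := Finset.sum_nonneg fun v (_ : v ∈ T \ S) => degIn_nonneg (G := G) S v
  linarith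

lemma edgeSum_le_sdiff {S T : Finset V} (h : T ⊆ S) :
    edgeSum G S ≤ edgeSum G (S \ T) + 2 * ∑ v ∈ T, degIn G S v := by
  have h1 := edgeSum_nonneg (G := G) T
  have h2 : ∑ v ∈ T, degIn G S v = ∑ v ∈ T, degIn G (S \ T) v + edgeSum G T := by
    rw [edgeSum, ← Finset.sum_add_distrib]
    refine Finset.sum_congr rfl fun v _ => ?_
    rw [← degIn_union Finset.sdiff_disjoint, Finset.sdiff_union_of_subset h]
  rw [h2]
  conv_lhs => rw [← Finset.sdiff_union_of_subset h, edgeSum_union Finset.sdiff_disjoint]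
  linarith

end

variable [Fintype V]

lemma sum_sum_neighborFinset (S : Finset V) (f : V → ℝ) :
    ∑ v ∈ S, ∑ w ∈ G.neighborFinset v, f w = ∑ w, degIn G S w * f w := by
  simp only [degIn, Finset.sum_mul, ite_mul, one_mul, zero_mul]
  rw [Finset.sum_comm]
  refine Finset.sum_congr rfl fun v _ => ?_
  rw [← Finset.sum_filter]
  refine Finset.sum_congr ?_ fun _ _ => rfl
  ext w
  simp [G.adj_comm]

lemma sum_degIn (S : Finset V) : ∑ w, degIn G S w = ∑ v ∈ S, (G.degree v : ℝ) := by
  have h := sum_sum_neighborFinset (G := G) S fun _ => 1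
  simpa using h.symm

variable (G) in
/-- The sum over `S` of the amounts by which the degrees fall short of the number `Δ + 1` of
colours. -/
def degreeDeficit (S : Finset V) : ℝ := ∑ v ∈ S, ((G.maxDegree : ℝ) + 1 - G.degree v)

lemma card_le_degreeDeficit (S : Finset V) : (S.card : ℝ) ≤ degreeDeficit G S := by
  rw [degreeDeficit, ← mul_one (S.card : ℝ), ← nsmul_eq_mul, ← Finset.sum_const]
  refine Finset.sum_le_sum fun v _ => ?_
  have : (G.degree v : ℝ) ≤ G.maxDegree := by exact_mod_cast G.degree_le_maxDegree v
  linarith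

lemma sum_degree_eq (S : Finset V) :
    ∑ v ∈ S, (G.degree v : ℝ) = (G.maxDegree + 1) * S.card - degreeDeficit G S := by
  rw [degreeDeficit, Finset.sum_sub_distrib, Finset.sum_const, nsmul_eq_mul]
  ring

lemma sq_sum_degree_le (S : Finset V) :
    ((G.maxDegree + 1) * S.card - degreeDeficit G S) ^ 2 ≤
      Fintype.card V * ∑ w, degIn G S w ^ 2 := by
  rw [← sum_degree_eq, ← sum_degIn]
  exact sq_sum_le_card_mul_sum_sq

variable [DecidableEq V]

lemma degIn_eq_card (S : Finset V) (v : V) : degIn G S v = (G.neighborFinset v ∩ S).card := by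
  rw [degIn, Finset.sum_boole]
  congr 2
  ext w
  simp [and_comm]

lemma degIn_le_card (S : Finset V) (v : V) : degIn G S v ≤ S.card := by
  rw [degIn_eq_card]
  exact_mod_cast Finset.card_le_card Finset.inter_subset_right

lemma degIn_le (S : Finset V) (v : V) : degIn G S v ≤ G.maxDegree + 1 := by
  rw [degIn_eq_card]
  have h1 := Finset.card_le_card (Finset.inter_subset_left : G.neighborFinset v ∩ S ⊆ _)
  have h2 := G.degree_le_maxDegree v
  rw [G.card_neighborFinset_eq_degree] at h1
  exact_mod_cast (h1.trans h2).trans (Nat.le_succ _)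

lemma edgeSum_le (S : Finset V) : edgeSum G S ≤ (G.maxDegree + 1) * S.card := by
  rw [edgeSum, mul_comm, ← nsmul_eq_mul, ← Finset.sum_const]
  exact Finset.sum_le_sum fun v _ => degIn_le _ _

end EdgeCounts

/-! ### Monochromatic neighbours -/

section SameColor

variable {V : Type u} [Fintype V] (G : SimpleGraph V) [DecidableRel G.Adj]

/-- The neighbours of `v` that have the colour of `v`. -/
def sameColorNbrs (c : Assignment G) (v : V) : Finset V := {w ∈ G.neighborFinset v | c w = c v}

/-- The number of ordered pairs of adjacent vertices of the same colour, as a real number. -/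
def monoSum (c : Assignment G) : ℝ := ∑ v, ((sameColorNbrs G c v).card : ℝ)

/-- The neighbours of `v` for which `v` is the only neighbour of the same colour: they stop being
conflicted when `v` loses its colour. -/
def pendantNbrs (c : Assignment G) (v : V) : Finset V :=
  {w ∈ sameColorNbrs G c v | (sameColorNbrs G c w).card = 1}

variable {G}

lemma mem_sameColorNbrs {c : Assignment G} {v w : V} :
    w ∈ sameColorNbrs G c v ↔ G.Adj v w ∧ c w = c v := by
  simp [sameColorNbrs]

lemma mem_sameColorNbrs_comm {c : Assignment G} {v w : V} :
    w ∈ sameColorNbrs G c v ↔ v ∈ sameColorNbrs G c w := by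
  simp [mem_sameColorNbrs, G.adj_comm, eq_comm]

lemma mem_conflicted_iff {c : Assignment G} {v : V} :
    v ∈ conflicted G c ↔ (sameColorNbrs G c v).Nonempty := by
  simp [conflicted, Finset.Nonempty, mem_sameColorNbrs, eq_comm]

lemma pendantNbrs_subset_conflicted (c : Assignment G) (v : V) :
    pendantNbrs G c v ⊆ conflicted G c := by
  intro w hw
  exact mem_conflicted_iff.2 ⟨v, mem_sameColorNbrs_comm.1 (Finset.mem_filter.1 hw).1⟩

lemma pendantNbrs_subset_neighborFinset (c : Assignment G) (v : V) :
    pendantNbrs G c v ⊆ G.neighborFinset v :=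
  (Finset.filter_subset _ _).trans (Finset.filter_subset _ _)

lemma notMem_pendantNbrs (c : Assignment G) (v : V) : v ∉ pendantNbrs G c v := fun h =>
  G.loopless.irrefl v (by simpa using pendantNbrs_subset_neighborFinset c v h)

lemma sum_conflicted_card_sameColorNbrs (c : Assignment G) :
    ∑ v ∈ conflicted G c, ((sameColorNbrs G c v).card : ℝ) = monoSum G c := by
  refine Finset.sum_subset (Finset.subset_univ _) fun v _ hv => ?_
  rw [mem_conflicted_iff, Finset.not_nonempty_iff_eq_empty] at hv
  simp [hv]

lemma filter_card_eq_one_subset (c : Assignment G) :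
    ({w | (sameColorNbrs G c w).card = 1} : Finset V) ⊆ conflicted G c := by
  intro w hw
  rw [mem_conflicted_iff, ← Finset.card_pos, (Finset.mem_filter.1 hw).2]
  exact one_pos

/-- A conflicted vertex has at least two neighbours of its colour, or exactly one. -/
lemma two_mul_card_conflicted_le (c : Assignment G) :
    2 * ((conflicted G c).card : ℝ) ≤
      monoSum G c + ({w | (sameColorNbrs G c w).card = 1} : Finset V).card := by
  have h1 : (({w | (sameColorNbrs G c w).card = 1} : Finset V).card : ℝ) =
      ∑ w ∈ conflicted G c, if (sameColorNbrs G c w).card = 1 then (1 : ℝ) else 0 := by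
    rw [Finset.sum_boole]
    congr 2
    ext w
    simp only [Finset.mem_filter, Finset.mem_univ, true_and]
    exact ⟨fun h => ⟨filter_card_eq_one_subset c (by simpa using h), h⟩, fun h => h.2⟩
  rw [h1, ← sum_conflicted_card_sameColorNbrs, ← Finset.sum_add_distrib, mul_comm,
    ← nsmul_eq_mul, ← Finset.sum_const]
  refine Finset.sum_le_sum fun w hw => ?_
  have h2 := Finset.card_pos.2 (mem_conflicted_iff.1 hw)
  split_ifs with h
  · rw [h]; norm_num
  · have h3 : 2 ≤ (sameColorNbrs G c w).card := by omega
    have : (2 : ℝ) ≤ (sameColorNbrs G c w).card := by exact_mod_cast h3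
    linarith

lemma card_conflicted_le_monoSum (c : Assignment G) :
    ((conflicted G c).card : ℝ) ≤ monoSum G c := by
  have h2 := two_mul_card_conflicted_le c
  have h4 : (({w | (sameColorNbrs G c w).card = 1} : Finset V).card : ℝ) ≤
      (conflicted G c).card := by exact_mod_cast Finset.card_le_card (filter_card_eq_one_subset c)
  linarith

lemma monoSum_le (c : Assignment G) : monoSum G c ≤ (G.maxDegree + 1) * Fintype.card V := by
  rw [monoSum, mul_comm, ← Finset.card_univ, ← nsmul_eq_mul, ← Finset.sum_const]
  refine Finset.sum_le_sum fun v _ => ?_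
  have h1 := Finset.card_le_card (Finset.filter_subset (fun w => c w = c v) (G.neighborFinset v))
  have h2 := G.degree_le_maxDegree v
  rw [G.card_neighborFinset_eq_degree] at h1
  exact_mod_cast (h1.trans h2).trans (Nat.le_succ _)

/-- Each vertex with exactly one neighbour of its colour is pendant at exactly one
conflicted vertex. -/
lemma sum_sum_pendantNbrs (c : Assignment G) (f : V → ℝ) :
    ∑ v ∈ conflicted G c, ∑ w ∈ pendantNbrs G c v, f w =
      ∑ w with (sameColorNbrs G c w).card = 1, f w := by
  rw [Finset.sum_comm' (t' := {w | (sameColorNbrs G c w).card = 1}) (s' := sameColorNbrs G c)]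
  · refine Finset.sum_congr rfl fun w hw => ?_
    rw [Finset.sum_const, (Finset.mem_filter.1 hw).2, one_smul]
  · intro v w
    simp only [pendantNbrs, Finset.mem_filter, Finset.mem_univ, true_and]
    rw [mem_sameColorNbrs_comm (v := v) (w := w)]
    constructor
    · tauto
    · rintro ⟨h1, h2⟩
      exact ⟨mem_conflicted_iff.2 ⟨w, mem_sameColorNbrs_comm.1 h1⟩, h1, h2⟩

variable [DecidableEq V]

variable (G) in
/-- The vertices other than `v` that are conflicted in `c` regardless of the colour of `v`, as
they have a neighbour of the same colour other than `v`. -/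
def survivors (c : Assignment G) (v : V) : Finset V := conflicted G c \ insert v (pendantNbrs G c v)

lemma pendantNbrs_subset_inter (c : Assignment G) (v : V) :
    pendantNbrs G c v ⊆ G.neighborFinset v ∩ conflicted G c :=
  Finset.subset_inter (pendantNbrs_subset_neighborFinset c v) (pendantNbrs_subset_conflicted c v)

lemma card_neighborFinset_sdiff_survivors (c : Assignment G) (v : V) :
    ((G.neighborFinset v \ survivors G c v).card : ℝ) =
      G.degree v - degIn G (conflicted G c) v + (pendantNbrs G c v).card := by
  have h1 : G.neighborFinset v ∩ survivors G c v =
      (G.neighborFinset v ∩ conflicted G c) \ pendantNbrs G c v := by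
    ext w
    simp only [survivors, Finset.mem_inter, Finset.mem_sdiff, Finset.mem_insert, not_or,
      SimpleGraph.mem_neighborFinset]
    constructor
    · tauto
    · rintro ⟨⟨h, h2⟩, h3⟩
      exact ⟨h, h2, h.ne', h3⟩
  have h2 := Finset.card_sdiff_add_card_inter (G.neighborFinset v) (survivors G c v)
  have h3 := Finset.card_sdiff_add_card_eq_card (pendantNbrs_subset_inter c v)
  rw [h1, G.card_neighborFinset_eq_degree] at h2
  rw [degIn_eq_card]
  have h2' : ((G.neighborFinset v \ survivors G c v).card : ℝ) +
    ((G.neighborFinset v ∩ conflicted G c) \ pendantNbrs G c v).card = G.degree v := by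
    exact_mod_cast h2
  have h3' : (((G.neighborFinset v ∩ conflicted G c) \ pendantNbrs G c v).card : ℝ) +
    (pendantNbrs G c v).card = (G.neighborFinset v ∩ conflicted G c).card := by exact_mod_cast h3
  linarith

lemma card_survivors {c : Assignment G} {v : V} (hv : v ∈ conflicted G c) :
    ((survivors G c v).card : ℝ) = (conflicted G c).card - 1 - (pendantNbrs G c v).card := by
  have h := Finset.card_sdiff_add_card_eq_card
    (Finset.insert_subset hv (pendantNbrs_subset_conflicted c v))
  rw [Finset.card_insert_of_notMem (notMem_pendantNbrs c v)] at h
  have h' : ((survivors G c v).card : ℝ) + ((pendantNbrs G c v).card + 1) =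
      (conflicted G c).card := by
    exact_mod_cast h
  linarith

end SameColor

/-! ### The potential -/

section Potential

variable {V : Type u} [Fintype V] {G : SimpleGraph V} [DecidableRel G.Adj]

variable (G) in
/-- The potential `6 D (M + k) - F`, where `D = Δ + 1`, `M` counts monochromatic ordered pairs, `k`
conflicted vertices, and `F` ordered adjacent pairs of conflicted vertices. Subtracting `F` rewards
configurations in which conflicts are about to meet. -/
def potential (c : Assignment G) : ℝ :=
  6 * (G.maxDegree + 1) * (monoSum G c + (conflicted G c).card) - edgeSum G (conflicted G c)

lemma potential_le (c : Assignment G) :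
    potential G c ≤ 12 * (G.maxDegree + 1) * monoSum G c := by
  have h1 := edgeSum_nonneg (G := G) (conflicted G c)
  have h2 := card_conflicted_le_monoSum c
  have h3 : ((G.maxDegree : ℝ) + 1) * (conflicted G c).card ≤ (G.maxDegree + 1) * monoSum G c := by
    gcongr
  rw [potential]
  linarith

variable [DecidableEq V]

lemma potential_nonneg (c : Assignment G) : 0 ≤ potential G c := by
  have h1 := edgeSum_le (G := G) (conflicted G c)
  have h2 : 0 ≤ monoSum G c := Finset.sum_nonneg fun _ _ => Nat.cast_nonneg _
  rw [potential]
  have h3 : (0 : ℝ) ≤ (G.maxDegree + 1) * monoSum G c := by positivity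
  have h4 : (0 : ℝ) ≤ (G.maxDegree + 1) * (conflicted G c).card := by positivity
  linarith

end Potential

/-! ### The effect of recolouring a vertex -/

section Drift

variable {V : Type u} [Fintype V] [DecidableEq V] {G : SimpleGraph V} [DecidableRel G.Adj]

lemma conflicted_update_subset (c : Assignment G) (v : V) (x : Fin (G.maxDegree + 1)) :
    conflicted G (Function.update c v x) ⊆
      insert v (survivors G c v ∪ ({w ∈ G.neighborFinset v | c w = x} \ survivors G c v)) := by
  intro u hu
  obtain ⟨w, hw⟩ := mem_conflicted_iff.1 hu
  rw [mem_sameColorNbrs] at hw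
  rw [Finset.mem_insert, Finset.union_sdiff_self_eq_union, Finset.mem_union]
  by_cases huv : u = v
  · exact Or.inl huv
  right
  rw [Function.update_of_ne huv] at hw
  by_cases hwv : w = v
  · subst hwv
    rw [Function.update_self] at hw
    exact Or.inr (by simp [hw.1.symm, hw.2])
  · rw [Function.update_of_ne hwv] at hw
    left
    have hm := mem_sameColorNbrs.2 hw
    refine Finset.mem_sdiff.2 ⟨mem_conflicted_iff.2 ⟨w, hm⟩, ?_⟩
    rw [Finset.mem_insert, not_or]
    refine ⟨huv, fun hl => ?_⟩
    obtain ⟨h1, h2⟩ := Finset.mem_filter.1 hl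
    exact hwv (Finset.card_le_one.1 h2.le w hm v (mem_sameColorNbrs_comm.1 h1))

lemma subset_conflicted_update (c : Assignment G) (v : V) (x : Fin (G.maxDegree + 1)) :
    survivors G c v ∪ ({w ∈ G.neighborFinset v | c w = x} \ survivors G c v) ⊆
      conflicted G (Function.update c v x) := by
  intro u hu
  rw [Finset.union_sdiff_self_eq_union, Finset.mem_union] at hu
  rw [mem_conflicted_iff]
  rcases hu with hu | hu
  · obtain ⟨huU, hu⟩ := Finset.mem_sdiff.1 hu
    rw [Finset.mem_insert, not_or] at hu
    obtain ⟨w, hw⟩ : ∃ w ∈ sameColorNbrs G c u, w ≠ v := by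
      by_contra! h
      refine hu.2 (Finset.mem_filter.2 ?_)
      obtain ⟨w, hw⟩ := mem_conflicted_iff.1 huU
      have hwv := h w hw
      subst hwv
      exact ⟨mem_sameColorNbrs_comm.1 hw,
        Finset.card_eq_one.2 ⟨w, Finset.eq_singleton_iff_unique_mem.2 ⟨hw, h⟩⟩⟩
    refine ⟨w, ?_⟩
    rw [mem_sameColorNbrs, Function.update_of_ne hu.1, Function.update_of_ne hw.2]
    exact mem_sameColorNbrs.1 hw.1
  · simp only [Finset.mem_filter, SimpleGraph.mem_neighborFinset] at hu
    refine ⟨v, ?_⟩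
    rw [mem_sameColorNbrs, Function.update_of_ne hu.1.ne', Function.update_self]
    exact ⟨hu.1.symm, hu.2.symm⟩

lemma sum_color_sum_filter (c : Assignment G) (S : Finset V) (T : Finset V) (f : V → ℝ) :
    ∑ x, ∑ w ∈ {w ∈ S | c w = x} \ T, f w = ∑ w ∈ S \ T, f w := by
  rw [← Finset.sum_fiberwise (S \ T) c f]
  refine Finset.sum_congr rfl fun x _ => Finset.sum_congr ?_ fun _ _ => rfl
  ext w
  simp only [Finset.mem_sdiff, Finset.mem_filter]
  tauto

lemma sum_card_conflicted_update_le {c : Assignment G} {v : V} (hv : v ∈ conflicted G c) :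
    ∑ x, (((conflicted G (Function.update c v x)).card : ℝ) - (conflicted G c).card) ≤
      G.degree v - degIn G (conflicted G c) v + (pendantNbrs G c v).card
        - (G.maxDegree + 1) * (pendantNbrs G c v).card := by
  -- besides the survivors, only `v` and its new neighbours of colour `x` can be conflicted
  have h : ∀ x, ((conflicted G (Function.update c v x)).card : ℝ) - (conflicted G c).card ≤
      ∑ w ∈ {w ∈ G.neighborFinset v | c w = x} \ survivors G c v, (1 : ℝ)
        - (pendantNbrs G c v).card := by
    intro x
    have h1 := (Finset.card_le_card (conflicted_update_subset c v x)).trans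
      ((Finset.card_insert_le _ _).trans (Nat.succ_le_succ (Finset.card_union_le _ _)))
    have h2 : ((conflicted G (Function.update c v x)).card : ℝ) ≤ (survivors G c v).card +
      ({w ∈ G.neighborFinset v | c w = x} \ survivors G c v).card + 1 := by exact_mod_cast h1
    rw [card_survivors hv] at h2
    rw [Finset.sum_const, nsmul_eq_mul, mul_one]
    linarith
  refine (Finset.sum_le_sum fun x _ => h x).trans ?_
  rw [Finset.sum_sub_distrib, sum_color_sum_filter, Finset.sum_const, nsmul_eq_mul, mul_one,
    card_neighborFinset_sdiff_survivors]
  simp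

lemma le_sum_edgeSum_update {c : Assignment G} {v : V} (hv : v ∈ conflicted G c) :
    2 * ∑ w ∈ G.neighborFinset v, degIn G (conflicted G c) w
        - (G.maxDegree + 1) * (4 * degIn G (conflicted G c) v
          + 2 * ∑ w ∈ pendantNbrs G c v, degIn G (conflicted G c) w
          + 2 * (1 + (pendantNbrs G c v).card)) ≤
      ∑ x, (edgeSum G (conflicted G (Function.update c v x)) - edgeSum G (conflicted G c)) := by
  set U := conflicted G c with hU
  set W := survivors G c v with hW
  set ℓ : ℝ := ((pendantNbrs G c v).card : ℝ) with hℓ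
  have hD : (0 : ℝ) ≤ G.maxDegree + 1 := by positivity
  have hZ : insert v (pendantNbrs G c v) ⊆ U :=
    Finset.insert_subset hv (pendantNbrs_subset_conflicted c v)
  have hZc : ((insert v (pendantNbrs G c v)).card : ℝ) = 1 + ℓ := by
    rw [Finset.card_insert_of_notMem (notMem_pendantNbrs c v)]; push_cast; ring
  have hWE : edgeSum G U ≤ edgeSum G W +
      2 * (degIn G U v + ∑ w ∈ pendantNbrs G c v, degIn G U w) := by
    have := edgeSum_le_sdiff (G := G) hZ
    rwa [Finset.sum_insert (notMem_pendantNbrs c v)] at this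
  have hdeg : ∀ w, degIn G U w - (1 + ℓ) ≤ degIn G W w := by
    intro w
    have h1 := degIn_union (G := G)
      (Finset.sdiff_disjoint (s := insert v (pendantNbrs G c v)) (t := U)) w
    rw [Finset.sdiff_union_of_subset hZ] at h1
    have h2 := degIn_le_card (G := G) (insert v (pendantNbrs G c v)) w
    have h3 : degIn G W w = degIn G (U \ insert v (pendantNbrs G c v)) w := rfl
    linarith
  -- the pairs inside the survivors and those joining a survivor to a new conflicted neighbour of
  -- `v` suffice; the pairs that involve `v` itself are given up
  have h : ∀ x, 2 * ∑ w ∈ {w ∈ G.neighborFinset v | c w = x} \ W, (degIn G U w - (1 + ℓ))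
      - 2 * (degIn G U v + ∑ w ∈ pendantNbrs G c v, degIn G U w) ≤
      edgeSum G (conflicted G (Function.update c v x)) - edgeSum G U := by
    intro x
    have h1 := edgeSum_mono (G := G) (subset_conflicted_update c v x)
    rw [edgeSum_union Finset.disjoint_sdiff, ← hW] at h1
    have h2 := edgeSum_nonneg (G := G) ({w ∈ G.neighborFinset v | c w = x} \ W)
    have h3 := Finset.sum_le_sum fun w (_ : w ∈ {w ∈ G.neighborFinset v | c w = x} \ W) => hdeg w
    linarith
  refine le_trans ?_ (Finset.sum_le_sum fun x _ => h x)
  rw [Finset.sum_sub_distrib, ← Finset.mul_sum, sum_color_sum_filter]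
  simp only [Finset.sum_sub_distrib, Finset.sum_const, nsmul_eq_mul, Finset.card_univ,
    Fintype.card_fin, Nat.cast_add, Nat.cast_one]
  have h4 : ∑ w ∈ G.neighborFinset v, degIn G U w - (G.maxDegree + 1) * degIn G U v ≤
      ∑ w ∈ G.neighborFinset v \ W, degIn G U w := by
    rw [← Finset.sum_inter_add_sum_sdiff (G.neighborFinset v) W]
    have h5 : ∑ w ∈ G.neighborFinset v ∩ W, degIn G U w ≤
        (G.maxDegree + 1) * degIn G U v := by
      calc _ ≤ ∑ w ∈ G.neighborFinset v ∩ W, ((G.maxDegree : ℝ) + 1) :=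
            Finset.sum_le_sum fun w _ => degIn_le _ _
        _ = (G.maxDegree + 1) * (G.neighborFinset v ∩ W).card := by
            rw [Finset.sum_const, nsmul_eq_mul, mul_comm]
        _ ≤ _ := by
            rw [degIn_eq_card]
            gcongr
            exact Finset.sdiff_subset
    linarith
  have h6 : ((G.neighborFinset v \ W).card : ℝ) ≤ G.maxDegree + 1 := by
    have h1 := Finset.card_le_card (Finset.sdiff_subset : G.neighborFinset v \ W ⊆ _)
    have h2 := G.degree_le_maxDegree v
    rw [G.card_neighborFinset_eq_degree] at h1
    exact_mod_cast (h1.trans h2).trans (Nat.le_succ _)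
  have h7 : ((G.neighborFinset v \ W).card : ℝ) * (1 + ℓ) ≤ (G.maxDegree + 1) * (1 + ℓ) := by
    gcongr
  linarith

lemma monoSum_update (c : Assignment G) (v : V) (x : Fin (G.maxDegree + 1)) :
    monoSum G (Function.update c v x) - monoSum G c =
      2 * (({w ∈ G.neighborFinset v | c w = x}.card : ℝ) - (sameColorNbrs G c v).card) := by
  -- the change of the indicator of a monochromatic pair is supported on the row and column of `v`
  set g : V → V → ℝ := fun u w =>
    (if G.Adj u w ∧ Function.update c v x w = Function.update c v x u then 1 else 0)
      - (if G.Adj u w ∧ c w = c u then 1 else 0) with hg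
  have hcard : ∀ (c' : Assignment G) u, ((sameColorNbrs G c' u).card : ℝ) =
      ∑ w, if G.Adj u w ∧ c' w = c' u then (1 : ℝ) else 0 := by
    intro c' u
    rw [Finset.sum_boole]
    congr 2
    ext w
    simp [mem_sameColorNbrs]
  have hsymm : ∀ u w, g u w = g w u := fun u w => by
    simp only [hg, G.adj_comm u w, eq_comm]
  have hzero : ∀ u w, u ≠ v → w ≠ v → g u w = 0 := fun u w hu hw => by
    simp [hg, Function.update_of_ne hu, Function.update_of_ne hw]
  have hvv : g v v = 0 := by simp [hg]
  have hrow : ∑ w, g v w =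
      ({w ∈ G.neighborFinset v | c w = x}.card : ℝ) - (sameColorNbrs G c v).card := by
    rw [hcard, hg, Finset.sum_sub_distrib, Finset.sum_boole]
    congr 3
    ext w
    simp only [Finset.mem_filter, Finset.mem_univ, true_and, SimpleGraph.mem_neighborFinset,
      Function.update_self]
    refine and_congr_right fun h => ?_
    rw [Function.update_of_ne h.ne']
  have htotal : monoSum G (Function.update c v x) - monoSum G c = ∑ u, ∑ w, g u w := by
    simp only [monoSum, hcard, hg, Finset.sum_sub_distrib]
  rw [htotal, ← Finset.add_sum_erase _ _ (Finset.mem_univ v), hrow]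
  have hrest : ∑ u ∈ Finset.univ.erase v, ∑ w, g u w = ∑ w, g v w := by
    rw [← Finset.add_sum_erase _ (fun w => g v w) (Finset.mem_univ v), hvv, zero_add]
    refine Finset.sum_congr rfl fun u hu => ?_
    rw [hsymm v u]
    exact Finset.sum_eq_single v (fun w _ hw => hzero u w (Finset.ne_of_mem_erase hu) hw) (by simp)
  rw [hrest, hrow]
  ring

lemma sum_monoSum_update (c : Assignment G) (v : V) :
    ∑ x, (monoSum G (Function.update c v x) - monoSum G c) =
      2 * (G.degree v - (G.maxDegree + 1) * (sameColorNbrs G c v).card) := by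
  have h := sum_color_sum_filter c (G.neighborFinset v) ∅ fun _ => 1
  simp only [Finset.sdiff_empty, Finset.sum_const, nsmul_eq_mul, mul_one,
    G.card_neighborFinset_eq_degree] at h
  simp only [monoSum_update, ← Finset.mul_sum, Finset.sum_sub_distrib, h]
  simp

/-! ### The drift summed over the conflicted vertices -/

lemma sum_drift_monoSum (c : Assignment G) :
    ∑ v ∈ conflicted G c, ∑ x, (monoSum G (Function.update c v x) - monoSum G c) =
      -2 * ((G.maxDegree + 1) * (monoSum G c - (conflicted G c).card)
        + degreeDeficit G (conflicted G c)) := by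
  simp only [sum_monoSum_update]
  simp only [← Finset.mul_sum, Finset.sum_sub_distrib]
  rw [sum_conflicted_card_sameColorNbrs, sum_degree_eq]
  ring

lemma sum_drift_card_le (c : Assignment G) :
    ∑ v ∈ conflicted G c, ∑ x,
        (((conflicted G (Function.update c v x)).card : ℝ) - (conflicted G c).card) ≤
      (G.maxDegree + 1) * (monoSum G c - (conflicted G c).card)
        - edgeSum G (conflicted G c) := by
  refine (Finset.sum_le_sum fun v hv => sum_card_conflicted_update_le hv).trans ?_
  have h1 := sum_sum_pendantNbrs c fun _ => 1
  simp only [Finset.sum_const, nsmul_eq_mul, mul_one] at h1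
  simp only [Finset.sum_sub_distrib, Finset.sum_add_distrib, ← Finset.mul_sum, h1, sum_degree_eq]
  have h2 := two_mul_card_conflicted_le c
  have h3 := card_le_degreeDeficit (G := G) (conflicted G c)
  have h4 : (({w | (sameColorNbrs G c w).card = 1} : Finset V).card : ℝ) ≤
      (conflicted G c).card := by exact_mod_cast Finset.card_le_card (filter_card_eq_one_subset c)
  have h5 : ((G.maxDegree : ℝ) + 1) * (2 * (conflicted G c).card) ≤ (G.maxDegree + 1) *
      (monoSum G c + ({w | (sameColorNbrs G c w).card = 1} : Finset V).card) := by gcongr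
  rw [← edgeSum]
  linarith

lemma le_sum_drift_edgeSum (c : Assignment G) :
    2 * ∑ w, degIn G (conflicted G c) w ^ 2
        - (G.maxDegree + 1) * (6 * edgeSum G (conflicted G c)
          + 4 * degreeDeficit G (conflicted G c)) ≤
      ∑ v ∈ conflicted G c, ∑ x,
        (edgeSum G (conflicted G (Function.update c v x)) - edgeSum G (conflicted G c)) := by
  refine le_trans ?_ (Finset.sum_le_sum fun v hv => le_sum_edgeSum_update hv)
  have h1 := sum_sum_pendantNbrs c fun _ => 1
  simp only [Finset.sum_const, nsmul_eq_mul, mul_one] at h1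
  simp only [Finset.sum_sub_distrib, Finset.sum_add_distrib, ← Finset.mul_sum, h1,
    sum_sum_neighborFinset, sum_sum_pendantNbrs, Finset.sum_const, nsmul_eq_mul, mul_one,
    ← sq]
  have h3 := card_le_degreeDeficit (G := G) (conflicted G c)
  have h4 : (({w | (sameColorNbrs G c w).card = 1} : Finset V).card : ℝ) ≤
      (conflicted G c).card := by exact_mod_cast Finset.card_le_card (filter_card_eq_one_subset c)
  have h5 : ∑ w with (sameColorNbrs G c w).card = 1, degIn G (conflicted G c) w ≤
      edgeSum G (conflicted G c) :=
    Finset.sum_le_sum_of_subset_of_nonneg (filter_card_eq_one_subset c)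
      fun _ _ _ => degIn_nonneg _ _
  apply sub_le_sub_left
  gcongr ?_ * ?_
  have h6 : ∑ v ∈ conflicted G c, degIn G (conflicted G c) v = edgeSum G (conflicted G c) := rfl
  linarith

lemma sum_drift_potential_le {c : Assignment G} (hc : (conflicted G c).Nonempty) :
    ∑ v ∈ conflicted G c, ∑ x, (potential G (Function.update c v x) - potential G c) ≤
      -((conflicted G c).card * (G.maxDegree + 1) *
        ((1 + potential G c / Fintype.card V) / 6)) := by
  have hn : (0 : ℝ) < Fintype.card V := by
    exact_mod_cast Fintype.card_pos_iff.2 ⟨hc.choose⟩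
  have hkn : ((conflicted G c).card : ℝ) ≤ Fintype.card V := by
    exact_mod_cast Finset.card_le_univ _
  have hM := sum_drift_monoSum c
  have hK := sum_drift_card_le c
  have hE := le_sum_drift_edgeSum c
  have hS := sq_sum_degree_le (G := G) (conflicted G c)
  have hσ := card_le_degreeDeficit (G := G) (conflicted G c)
  have hkM := card_conflicted_le_monoSum c
  have hP := potential_le c
  have hsplit : ∑ v ∈ conflicted G c, ∑ x,
      (potential G (Function.update c v x) - potential G c) =
      6 * (G.maxDegree + 1) *
        (∑ v ∈ conflicted G c, ∑ x, (monoSum G (Function.update c v x) - monoSum G c)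
        + ∑ v ∈ conflicted G c, ∑ x,
          (((conflicted G (Function.update c v x)).card : ℝ) - (conflicted G c).card))
      - ∑ v ∈ conflicted G c, ∑ x,
        (edgeSum G (conflicted G (Function.update c v x)) - edgeSum G (conflicted G c)) := by
    simp only [potential, ← Finset.sum_add_distrib, ← Finset.sum_sub_distrib, Finset.mul_sum]
    refine Finset.sum_congr rfl fun v _ => Finset.sum_congr rfl fun x _ => ?_
    ring
  rw [hsplit, hM]
  set D : ℝ := (G.maxDegree : ℝ) + 1 with hD
  set k : ℝ := ((conflicted G c).card : ℝ) with hk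
  set n : ℝ := (Fintype.card V : ℝ)
  set M := monoSum G c
  set σ := degreeDeficit G (conflicted G c)
  set F := edgeSum G (conflicted G c)
  set R := ∑ w, degIn G (conflicted G c) w ^ 2
  set K := ∑ v ∈ conflicted G c, ∑ x,
          (((conflicted G (Function.update c v x)).card : ℝ) - k)
  set P := potential G c
  have hD0 : 0 < D := by positivity
  have hk0 : 0 ≤ k := Nat.cast_nonneg _
  have hσ0 : 0 ≤ σ := hk0.trans hσ
  -- Cauchy–Schwarz, with the deficit split off using `k ≤ n`
  have hR : D ^ 2 * k * (k / n) - 2 * D * σ ≤ R := by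
    have h1 : (D * k) ^ 2 - 2 * (D * k) * σ ≤ n * R := by nlinarith [sq_nonneg σ]
    have h2 : 2 * (D * k) * σ ≤ n * (2 * D * σ) := by
      have : k * (2 * D * σ) ≤ n * (2 * D * σ) := by gcongr
      linarith
    rw [← mul_le_mul_iff_right₀ hn]
    have h3 : n * (D ^ 2 * k * (k / n) - 2 * D * σ) = (D * k) ^ 2 - n * (2 * D * σ) := by
      field_simp
    linarith
  have he : k / n * (M - k) ≤ M - k :=
    mul_le_of_le_one_left (by linarith) ((div_le_one hn).2 hkn)
  have he' : D ^ 2 * (k / n * (M - k)) ≤ D ^ 2 * (M - k) := by gcongr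
  have hPn : D * k * (P / n) ≤ D * k * (12 * D * (M / n)) := by
    have : P / n ≤ 12 * D * (M / n) := by
      rw [← mul_div_assoc]
      gcongr
    gcongr
  have hKD : D * K ≤ D * (D * (M - k) - F) := by gcongr
  have hσD : D * k ≤ D * σ := by gcongr
  have hsq : 0 ≤ D ^ 2 * (M - k) := mul_nonneg (by positivity) (by linarith)
  have hDk : 0 ≤ D * k := by positivity
  have e1 : D ^ 2 * (k / n * (M - k)) = D * k * (D * (M / n)) - D ^ 2 * k * (k / n) := by
    field_simp
  have e2 : k * D * ((1 + P / n) / 6) = D * k / 6 + D * k * (P / n) / 6 := by ring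
  rw [e2]
  linarith

/-! ### The logarithmic Lyapunov function -/

variable (G) in
/-- The concave transform `6 n log (1 + Φ / n)` of the potential `Φ`; it is `0` for the empty
graph, where `n = 0`. -/
noncomputable def lyapunov (c : Assignment G) : ℝ :=
  6 * Fintype.card V * Real.log (1 + potential G c / Fintype.card V)

lemma lyapunov_nonneg (c : Assignment G) : 0 ≤ lyapunov G c := by
  have := potential_nonneg c
  exact mul_nonneg (by positivity) (Real.log_nonneg (le_add_of_nonneg_right (by positivity)))

lemma log_sub_log_le {a b : ℝ} (ha : 0 < a) (hb : 0 < b) :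
    Real.log b - Real.log a ≤ (b - a) / a := by
  rw [← Real.log_div hb.ne' ha.ne', sub_div, div_self ha.ne']
  exact Real.log_le_sub_one_of_pos (by positivity)

lemma sum_drift_lyapunov_le {c : Assignment G} (hc : (conflicted G c).Nonempty) :
    ∑ v ∈ conflicted G c, ∑ x, (lyapunov G (Function.update c v x) - lyapunov G c) ≤
      -((conflicted G c).card * (G.maxDegree + 1)) := by
  have hn : (0 : ℝ) < Fintype.card V := by
    exact_mod_cast Fintype.card_pos_iff.2 ⟨hc.choose⟩
  have hpos : ∀ c' : Assignment G, 0 < 1 + potential G c' / Fintype.card V := fun c' => by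
    have := potential_nonneg c'
    positivity
  have hterm : ∀ c' : Assignment G, lyapunov G c' - lyapunov G c ≤
      6 / (1 + potential G c / Fintype.card V) * (potential G c' - potential G c) := by
    intro c'
    have h := log_sub_log_le (hpos c) (hpos c')
    calc lyapunov G c' - lyapunov G c = 6 * Fintype.card V *
          (Real.log (1 + potential G c' / Fintype.card V)
            - Real.log (1 + potential G c / Fintype.card V)) := by rw [lyapunov, lyapunov]; ring
      _ ≤ 6 * Fintype.card V * ((1 + potential G c' / Fintype.card V
          - (1 + potential G c / Fintype.card V)) / (1 + potential G c / Fintype.card V)) := by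
        gcongr
      _ = _ := by
        have := (hpos c).ne'
        field_simp
        ring
  refine (Finset.sum_le_sum fun v _ => Finset.sum_le_sum fun x _ => hterm _).trans ?_
  simp only [← Finset.mul_sum]
  have h6 : 0 ≤ 6 / (1 + potential G c / Fintype.card V) := (div_pos (by norm_num) (hpos c)).le
  refine (mul_le_mul_of_nonneg_left (sum_drift_potential_le hc) h6).trans_eq ?_
  have := (hpos c).ne'
  generalize 1 + potential G c / Fintype.card V = y at *
  field_simp

lemma lyapunov_le (c : Assignment G) :
    lyapunov G c ≤ 48 * Fintype.card V * Real.log (max G.maxDegree 2 : ℕ) := by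
  rcases Nat.eq_zero_or_pos (Fintype.card V) with h0 | hpos
  · simp [lyapunov, h0]
  have hn : (0 : ℝ) < Fintype.card V := by exact_mod_cast hpos
  set a : ℝ := ((max G.maxDegree 2 : ℕ) : ℝ) with ha
  have ha2 : 2 ≤ a := by rw [ha]; exact_mod_cast le_max_right _ _
  have haΔ : (G.maxDegree : ℝ) ≤ a := by rw [ha]; exact_mod_cast le_max_left _ _
  have h1 : potential G c / Fintype.card V ≤ 12 * (G.maxDegree + 1) ^ 2 := by
    rw [div_le_iff₀ hn]
    have h := monoSum_le c
    have : 12 * (G.maxDegree + 1) * monoSum G c ≤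
      12 * (G.maxDegree + 1) * ((G.maxDegree + 1) * Fintype.card V) := by gcongr
    linarith [potential_le c]
  -- `1 + 12 D ^ 2 ≤ 49 a ^ 2 ≤ a ^ 8` as `D ≤ 2 a` and `2 ≤ a`
  have h2 : 1 + potential G c / Fintype.card V ≤ a ^ 8 := by
    have h3 : ((G.maxDegree : ℝ) + 1) ^ 2 ≤ (2 * a) ^ 2 := by gcongr; linarith
    have h4 : (2 : ℝ) ^ 6 ≤ a ^ 6 := by gcongr
    have h5 : 2 ^ 6 * a ^ 2 ≤ a ^ 6 * a ^ 2 := by gcongr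
    nlinarith
  have h3 : Real.log (1 + potential G c / Fintype.card V) ≤ 8 * Real.log a := by
    have h := Real.log_le_log (add_pos_of_pos_of_nonneg one_pos
      (div_nonneg (potential_nonneg c) hn.le)) h2
    rwa [Real.log_pow] at h
  calc lyapunov G c ≤ 6 * Fintype.card V * (8 * Real.log a) := by rw [lyapunov]; gcongr
    _ = _ := by ring

end Drift

end DecentralizedColoring

theorem theorem1 :
    ∃ C : ℝ, 0 < C ∧
      ∀ (V : Type*) [Fintype V] [DecidableEq V] (G : SimpleGraph V) [DecidableRel G.Adj],
        DecentralizedColoring.expectedSteps G (DecentralizedColoring.uniformStart G) ≤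
            ENNReal.ofReal (C * Fintype.card V * Real.log (max G.maxDegree 2 : ℕ)) ∧
          ∀ c₀ : DecentralizedColoring.Assignment G,
            DecentralizedColoring.expectedSteps G (Measure.dirac c₀) ≤
              ENNReal.ofReal (C * Fintype.card V * Real.log (max G.maxDegree 2 : ℕ)) := by
  refine ⟨48, by norm_num, fun V _ _ G _ => ?_⟩
  have h : ∀ (μ₀ : Measure (DecentralizedColoring.Assignment G)) [IsProbabilityMeasure μ₀],
      DecentralizedColoring.expectedSteps G μ₀ ≤
        ENNReal.ofReal (48 * Fintype.card V * Real.log (max G.maxDegree 2 : ℕ)) := fun μ₀ _ =>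
    DecentralizedColoring.expectedSteps_le_ofReal G μ₀ (DecentralizedColoring.lyapunov G) _
      DecentralizedColoring.lyapunov_nonneg DecentralizedColoring.lyapunov_le
      fun _ hc => DecentralizedColoring.sum_drift_lyapunov_le hc
  refine ⟨?_, fun c₀ => h _⟩
  have : ∀ _ : V, IsProbabilityMeasure
      (PMF.uniformOfFintype (Fin (G.maxDegree + 1))).toMeasure :=
    fun _ => PMF.toMeasure.isProbabilityMeasure _
  have : IsProbabilityMeasure (DecentralizedColoring.uniformStart G) := by
    unfold DecentralizedColoring.uniformStart; infer_instance
  exact h _
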